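/- Let $N\ge 1$ and $M\ge 1$ be integers. The cobweb lattice $\mathcal{C}_{N\times M}$ with $N$ spokes and $M$ concentric circles has a center $O$ and the vertices $v_{m,i}$ with $0\le m<M$ and $i\in\mathbb{Z}/N\mathbb{Z}$. Its edges are the $NM$ spoke edges, which join $v_{0,i}$ to $O$ and $v_{m,i}$ to $v_{m-1,i}$ for $1\le m<M$, each of weight $x$, and the $NM$ circle edges, one joining $v_{m,i}$ to $v_{m,i+1}$ for each $(m,i)$, each of weight $y$. (The graph is simple for $N\ge 3$; for $N=2$ each circle consists of two parallel edges, and for $N=1$ of a loop.) Let $$f_{\mathcal{C}_{N\times M}}(x,y)=\sum_{T}\ \prod_{e\in E(T)}\omega(e)$$ be its spanning tree generating function, where $T$ runs over all spanning trees of $\mathcal{C}_{N\times M}$ and $\omega(e)\in\{x,y\}$ is the weight of $e$. For $1\le j\le N-1$ put $$a_j=\sin\frac{\pi j}{N},\qquad \lambda_{j,1},\lambda_{j,2}=2a_j\Bigl(a_jy\pm\sqrt{a_j^2y^2+xy}\Bigr)+x,$$ where $\sqrt{\cdot}$ is either of the two complex square roots. Then for all complex numbers $x,y$ with $\lambda_{j,1}\neq\lambda_{j,2}$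 for $1\le j\le N-1$ (in particular for all positive real $x,y$), $$f_{\mathcal{C}_{N\times M}}(x,y)=x^M\prod_{j=1}^{N-1}\frac{(4a_j^2y+x)(\lambda_{j,1}^M-\lambda_{j,2}^M)-x^2(\lambda_{j,1}^{M-1}-\lambda_{j,2}^{M-1})}{\lambda_{j,1}-\lambda_{j,2}}.$$ -/

import Mathlib

/-- In the multigraph with vertex set `V` in which the edge `e : E` has the (possibly equal) end
vertices `ends e`, the edge set `F` is the edge set of a spanning tree: it contains no loops and
no parallel edges, and the simple graph on `V` that it then forms is a tree. -/
structure IsSpanningTree {V E : Type*} (ends : E → Sym2 V) (F : Finset E) : Prop where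
  no_loop : ∀ e ∈ F, ¬ (ends e).IsDiag
  no_parallel : Set.InjOn ends (F : Set E)
  isTree : (SimpleGraph.fromEdgeSet (ends '' (F : Set E))).IsTree

open Classical in
/-- The weighted spanning tree enumerator: the sum over all spanning trees `F` of the product of
the weights `w e` of the edges of `F`. -/
noncomputable def spanningTreeSum {V E R : Type*} [Fintype E] [CommSemiring R]
    (ends : E → Sym2 V) (w : E → R) : R :=
  ∑ F : Finset E with IsSpanningTree ends F, ∏ e ∈ F, w e

/-- The vertices of the cobweb lattice with `N` spokes and `M` concentric circles: `none` is the
center and `some (m, i)` is the vertex on spoke `i` and circle `m` (circle `0` is the innermost). -/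
abbrev CobwebVertex (N M : ℕ) : Type := Option (Fin M × ZMod N)

/-- The edges of the cobweb lattice: `Sum.inl (m, i)` is the spoke edge that joins the vertex
`(m, i)` to its neighbour nearer to the center, and `Sum.inr (m, i)` is the circle edge that joins
`(m, i)` to the next vertex `(m, i + 1)` of its circle. -/
abbrev CobwebEdge (N M : ℕ) : Type := (Fin M × ZMod N) ⊕ (Fin M × ZMod N)

/-- The neighbour of the vertex `(m, i)` on its spoke in the direction of the center. -/
def cobwebInner {N M : ℕ} (v : Fin M × ZMod N) : CobwebVertex N M :=
  if v.1.val = 0 then none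
  else some (⟨v.1.val - 1, lt_of_le_of_lt (Nat.sub_le _ _) v.1.isLt⟩, v.2)

/-- The end vertices of the edges of the cobweb lattice. -/
def cobwebEnds (N M : ℕ) : CobwebEdge N M → Sym2 (CobwebVertex N M)
  | Sum.inl v => s(some v, cobwebInner v)
  | Sum.inr v => s(some v, some (v.1, v.2 + 1))

/-- The weights: every spoke edge has weight `x` and every circle edge has weight `y`. -/
def cobwebWeight {R : Type*} (N M : ℕ) (x y : R) : CobwebEdge N M → R
  | Sum.inl _ => x
  | Sum.inr _ => y

/-- The spanning tree generating function of the cobweb lattice with `N` spokes of weight `x` and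
`M` concentric circles of weight `y`. -/
noncomputable def cobwebGF {R : Type*} [CommSemiring R] (N M : ℕ) [NeZero N] (x y : R) : R :=
  spanningTreeSum (cobwebEnds N M) (cobwebWeight N M x y)

/-! By the weighted matrix tree theorem, the sum over spanning trees is the determinant of the
Laplacian with the row and column of the center deleted. This follows by Cauchy–Binet, since a
maximal minor of the reduced incidence matrix is ±1 on a spanning tree and 0 otherwise
(`spanningTreeSum_eq_det`). Rotational symmetry lets the characters of `ZMod N` block-diagonalize
this Laplacian (`circleFourier_conj_laplacian`). The block at frequency `j` is tridiagonal in the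
radial direction, with `μ = 4 * a j ^ 2 * y` added on the diagonal. Its determinant satisfies a
linear recurrence in `M` whose characteristic roots are `lam₁ j` and `lam₂ j`
(`det_radialMatrix_mul_sub`). Frequency 0 contributes `x ^ M`. -/

/-! ### Cauchy–Binet with edge weights -/

section CauchyBinet

open Finset Matrix

variable {n E R : Type*} [Fintype n] [DecidableEq n] [Fintype E] [CommRing R]

theorem det_mul_eq_sum_functions (A : Matrix n E R) (B : Matrix E n R) :
    (A * B).det = ∑ f : n → E, (∏ i, A i (f i)) * (B.submatrix f id).det := by
  have h : A * B = fun i => ∑ e, A i e • B e := by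
    ext i j
    simp [Matrix.mul_apply, Finset.sum_apply]
  have h2 := (detRowAlternating : (n → R) [⋀^n]→ₗ[R] R).toMultilinearMap.map_sum
    (fun i e => A i e • B e)
  rw [h]
  refine h2.trans (Finset.sum_congr rfl fun f _ => ?_)
  exact (detRowAlternating : (n → R) [⋀^n]→ₗ[R] R).toMultilinearMap.map_smul_univ _ _

/-- The coefficient of `∏ e ∈ F, w e` in the determinant of `Bᵀ * diagonal w * B`. -/
noncomputable def minorSqSum [DecidableEq E] (B : Matrix E n R) (F : Finset E) : R :=
  ∑ f : n → E with univ.image f = F, (∏ i, B (f i) i) * (B.submatrix f id).det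

variable [DecidableEq E]

/-- The functions with the same image as `f` are the `f ∘ σ`. Permuting the rows gives the sign of
`σ`, so the products assemble into a second copy of the minor by the Leibniz formula. -/
theorem minorSqSum_image (B : Matrix E n R) {f : n → E} (hf : Function.Injective f) :
    minorSqSum B (univ.image f) = (B.submatrix f id).det ^ 2 := by
  have key : minorSqSum B (univ.image f) =
      ∑ σ : Equiv.Perm n, (∏ i, B (f (σ i)) i) * (B.submatrix (f ∘ σ) id).det := by
    symm
    refine Finset.sum_bij (fun σ _ => f ∘ σ) ?_ ?_ ?_ ?_
    · intro σ _
      simp only [mem_filter, mem_univ, true_and]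
      rw [← Finset.image_image]
      simp
    · intro σ _ τ _ h
      ext i
      exact hf (congrFun h i)
    · intro g hg
      simp only [mem_filter, mem_univ, true_and] at hg
      have hr : ∀ i, ∃ j, f j = g i := fun i => by
        have : g i ∈ univ.image f := hg ▸ mem_image_of_mem g (mem_univ i)
        simpa using this
      choose σ hσ using hr
      have hsurj : Function.Surjective σ := fun j => by
        have : f j ∈ univ.image g := hg ▸ mem_image_of_mem f (mem_univ j)
        obtain ⟨i, -, hi⟩ := mem_image.1 this
        exact ⟨i, hf ((hσ i).trans hi)⟩
      exact ⟨Equiv.ofBijective σ (Finite.injective_iff_bijective.1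
        (Finite.injective_iff_surjective.2 hsurj)), mem_univ _, funext hσ⟩
    · intro σ _
      rfl
  rw [key, sq]
  nth_rw 1 [det_apply' (B.submatrix f id)]
  rw [Finset.sum_mul]
  refine Finset.sum_congr rfl fun σ _ => ?_
  have := det_permute σ (B.submatrix f id)
  rw [submatrix_submatrix] at this
  simp only [Function.id_comp] at this
  rw [this]
  simp only [submatrix_apply, id]
  ring

theorem minorSqSum_of_card_ne (B : Matrix E n R) {F : Finset E} (hF : #F ≠ Fintype.card n) :
    minorSqSum B F = 0 := by
  refine Finset.sum_eq_zero fun f hf => ?_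
  have hf : univ.image f = F := by simpa using hf
  have : ¬ Function.Injective f := fun h => hF (by rw [← hf, card_image_of_injective _ h]; rfl)
  simp only [Function.Injective, not_forall] at this
  obtain ⟨i, j, hij, hne⟩ := this
  rw [det_zero_of_row_eq hne (by ext k; simp [hij]), mul_zero]

theorem det_transpose_mul_diagonal_mul (B : Matrix E n R) (w : E → R) :
    (Bᵀ * diagonal w * B).det = ∑ F : Finset E, (∏ e ∈ F, w e) * minorSqSum B F := by
  rw [det_mul_eq_sum_functions, ← Finset.sum_fiberwise univ (fun f : n → E => univ.image f)]
  refine Finset.sum_congr rfl fun F _ => ?_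
  rw [minorSqSum, Finset.mul_sum]
  refine Finset.sum_congr rfl fun f hf => ?_
  have hf : univ.image f = F := by simpa using hf
  by_cases hinj : Function.Injective f
  · rw [← hf, Finset.prod_image hinj.injOn]
    simp only [mul_diagonal, transpose_apply, Finset.prod_mul_distrib]
    ring
  · simp only [Function.Injective, not_forall] at hinj
    obtain ⟨i, j, hij, hne⟩ := hinj
    rw [det_zero_of_row_eq hne (by ext k; simp [hij]), mul_zero, mul_zero, mul_zero]

end CauchyBinet

/-! ### The weighted matrix tree theorem -/

section MatrixTree

open Finset Matrix

/-- A connected graph on `Fintype.card n + 1` vertices has at least `Fintype.card n` edges. A loop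
or a parallel pair in `F` would leave the simple graph with fewer. -/
theorem isSpanningTree_iff {n E : Type*} [Fintype n] {ends : E → Sym2 (Option n)} {F : Finset E} :
    IsSpanningTree ends F ↔ #F = Fintype.card n ∧
      (SimpleGraph.fromEdgeSet (ends '' (F : Set E))).Connected := by
  classical
  have hV : Nat.card (Option n) = Fintype.card n + 1 := by simp
  have hle : Nat.card (SimpleGraph.fromEdgeSet (ends '' (F : Set E))).edgeSet ≤
      Set.ncard (ends '' (F : Set E)) := by
    rw [SimpleGraph.edgeSet_fromEdgeSet]
    exact Set.ncard_le_ncard Set.sdiff_subset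
  have hle2 : Set.ncard (ends '' (F : Set E)) ≤ #F := by
    simpa using Set.ncard_image_le (f := ends) F.finite_toSet
  constructor
  · intro h
    refine ⟨?_, h.isTree.connected⟩
    have h1 := (SimpleGraph.isTree_iff_connected_and_card.1 h.isTree).2
    have h2 : (ends '' (F : Set E)) \ {e | e.IsDiag} = ends '' (F : Set E) := by
      rw [sdiff_eq_left, Set.disjoint_left]
      rintro _ ⟨e, he, rfl⟩
      exact h.no_loop e he
    rw [SimpleGraph.edgeSet_fromEdgeSet] at h1
    have h3 : Nat.card ↑((ends '' (F : Set E)) \ {e | e.IsDiag}) = #F := by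
      rw [h2]
      change Set.ncard _ = _
      rw [h.no_parallel.ncard_image, Set.ncard_coe_finset]
    have h4 : Nat.card ↑((ends '' (F : Set E)) \ {e | e.IsDiag}) + 1 = _ := h1
    omega
  · rintro ⟨hc, hconn⟩
    have h1 := hconn.card_vert_le_card_edgeSet_add_one
    refine ⟨?_, ?_, SimpleGraph.isTree_iff_connected_and_card.2 ⟨hconn, by omega⟩⟩
    · intro e he hd
      have : Set.ncard ((ends '' (F : Set E)) \ {e | e.IsDiag}) <
          Set.ncard (ends '' (F : Set E)) :=
        Set.ncard_lt_ncard ⟨Set.sdiff_subset, fun hs => (hs ⟨e, he, rfl⟩).2 hd⟩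
      have h5 : Nat.card (SimpleGraph.fromEdgeSet (ends '' (F : Set E))).edgeSet =
          Set.ncard ((ends '' (F : Set E)) \ {e | e.IsDiag}) := by
        rw [SimpleGraph.edgeSet_fromEdgeSet]; rfl
      omega
    · refine Set.injOn_of_ncard_image_eq ?_ F.finite_toSet
      rw [Set.ncard_coe_finset]
      omega

variable {n E : Type*} [DecidableEq n]

/-- The incidence matrix of the directed multigraph on `Option n` whose edge `e` leads from `src e`
to `tgt e`, without the column of the vertex `none`. -/
def reducedIncidence (R : Type*) [Ring R] (src tgt : E → Option n) : Matrix E n R :=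
  fun e v => (if src e = some v then 1 else 0) - (if tgt e = some v then 1 else 0)

theorem reducedIncidence_mul_apply {R κ : Type*} [Ring R] [Fintype n] (src tgt : E → Option n)
    (P : Matrix n κ R) (e : E) (c : κ) :
    (reducedIncidence R src tgt * P) e c =
      (src e).elim 0 (fun v => P v c) - (tgt e).elim 0 (fun v => P v c) := by
  have h (o : Option n) :
      ∑ v, (if o = some v then 1 else 0) * P v c = o.elim 0 (fun v => P v c) := by
    cases o <;> simp
  simp only [Matrix.mul_apply, reducedIncidence, sub_mul, Finset.sum_sub_distrib, h]

theorem reducedIncidence_mulVec {R : Type*} [Ring R] [Fintype n] (src tgt : E → Option n)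
    (z : n → R) (e : E) :
    (reducedIncidence R src tgt *ᵥ z) e = (src e).elim 0 z - (tgt e).elim 0 z :=
  reducedIncidence_mul_apply src tgt (fun v (_ : Unit) => z v) e ()

theorem map_reducedIncidence (R : Type*) [Ring R] (src tgt : E → Option n) :
    (reducedIncidence ℤ src tgt).map (Int.castRingHom R) = reducedIncidence R src tgt := by
  ext e v
  simp [reducedIncidence]

variable [Fintype n]

/-- The row span contains the difference of the basis vectors at the ends of each edge. The root
stands for 0, so walking from it yields every basis vector, hence an integral left inverse. -/
theorem isUnit_det_reducedIncidence {src tgt : E → Option n} {f : n → E}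
    (h : (SimpleGraph.fromEdgeSet
      ((fun e => s(src e, tgt e)) '' Set.range f)).Connected) :
    IsUnit ((reducedIncidence ℤ src tgt).submatrix f id).det := by
  set B := (reducedIncidence ℤ src tgt).submatrix f id
  let δ : Option n → n → ℤ := fun o v => if o = some v then 1 else 0
  let S := LinearMap.range (Matrix.vecMulLinear B)
  have hrow (i : n) : δ (src (f i)) - δ (tgt (f i)) ∈ S := by
    refine ⟨Pi.single i 1, ?_⟩
    rw [Matrix.vecMulLinear_apply, Matrix.single_one_vecMul]
    rfl
  have hadj (a b : Option n) (hab : (SimpleGraph.fromEdgeSet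
      ((fun e => s(src e, tgt e)) '' Set.range f)).Adj a b) : δ a - δ b ∈ S := by
    rw [SimpleGraph.fromEdgeSet_adj] at hab
    obtain ⟨⟨_, ⟨i, rfl⟩, he⟩, -⟩ := hab
    have he : s(src (f i), tgt (f i)) = s(a, b) := he
    rcases Sym2.eq_iff.1 he with ⟨h1, h2⟩ | ⟨h1, h2⟩
    · rw [← h1, ← h2]; exact hrow i
    · rw [← h1, ← h2, ← neg_sub]; exact S.neg_mem (hrow i)
  have hall (o : Option n) : δ o ∈ S := by
    have hr := (SimpleGraph.reachable_iff_reflTransGen none o).1 (h.preconnected none o)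
    induction hr with
    | refl =>
      have : δ none = 0 := by ext; simp [δ]
      rw [this]; exact S.zero_mem
    | tail _ hbc ih =>
      have := S.sub_mem ih (hadj _ _ hbc)
      simpa using this
  have hleft : ∃ C : Matrix n n ℤ, C * B = 1 := by
    choose c hc using fun v => hall (some v)
    refine ⟨Matrix.of c, ?_⟩
    ext u v
    refine (congrFun (hc u) v).trans ?_
    simp [δ, Matrix.one_apply]
  obtain ⟨C, hC⟩ := hleft
  exact isUnit_iff_exists_inv'.2 ⟨C.det, by rw [← Matrix.det_mul, hC, Matrix.det_one]⟩

/-- The indicator of the vertices not reachable from the root is constant along edges, so it is a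
nonzero kernel vector. -/
theorem det_reducedIncidence_eq_zero {src tgt : E → Option n} {f : n → E}
    (h : ¬ (SimpleGraph.fromEdgeSet
      ((fun e => s(src e, tgt e)) '' Set.range f)).Connected) :
    ((reducedIncidence ℤ src tgt).submatrix f id).det = 0 := by
  classical
  set G := SimpleGraph.fromEdgeSet ((fun e => s(src e, tgt e)) '' Set.range f)
  have hex : ∃ v : n, ¬ G.Reachable none (some v) := by
    by_contra! hcon
    have hall : ∀ o, G.Reachable none o := fun o => by
      cases o with
      | none => exact .rfl
      | some v => exact hcon v
    exact h ⟨fun a b => (hall a).symm.trans (hall b)⟩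
  obtain ⟨v, hv⟩ := hex
  let z : n → ℤ := fun u => if G.Reachable none (some u) then 0 else 1
  have hz (o : Option n) : o.elim 0 z = if G.Reachable none o then 0 else 1 := by
    cases o <;> simp [z]
  refine Matrix.exists_mulVec_eq_zero_iff.1 ⟨z, fun h0 => ?_, ?_⟩
  · have := congrFun h0 v
    simp [z, hv] at this
  · ext i
    have := reducedIncidence_mulVec src tgt z (f i)
    change (reducedIncidence ℤ src tgt *ᵥ z) (f i) = 0
    rw [this, hz, hz]
    by_cases heq : src (f i) = tgt (f i)
    · rw [heq, sub_self]
    · have hadj : G.Adj (src (f i)) (tgt (f i)) := by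
        rw [SimpleGraph.fromEdgeSet_adj]
        exact ⟨⟨f i, ⟨i, rfl⟩, rfl⟩, heq⟩
      have : G.Reachable none (src (f i)) ↔ G.Reachable none (tgt (f i)) :=
        ⟨fun h => h.trans hadj.reachable, fun h => h.trans hadj.symm.reachable⟩
      simp [this]

variable [Fintype E]

/-- The weighted matrix tree theorem for multigraphs, in incidence matrix form. -/
theorem spanningTreeSum_eq_det {R : Type*} [CommRing R] [DecidableEq E] (src tgt : E → Option n)
    (w : E → R) :
    spanningTreeSum (fun e => s(src e, tgt e)) w =
      ((reducedIncidence R src tgt)ᵀ * diagonal w * reducedIncidence R src tgt).det := by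
  classical
  rw [det_transpose_mul_diagonal_mul, spanningTreeSum, Finset.sum_filter]
  refine Finset.sum_congr rfl fun F _ => ?_
  by_cases hc : #F = Fintype.card n
  · obtain ⟨φ⟩ : Nonempty (n ≃ F) := ⟨Fintype.equivOfCardEq (by simp [hc])⟩
    let f : n → E := fun i => φ i
    have hf : Function.Injective f := Subtype.val_injective.comp φ.injective
    have hr : Set.range f = F := by
      ext e
      refine ⟨?_, fun he => ⟨φ.symm ⟨e, he⟩, by simp [f]⟩⟩
      rintro ⟨i, rfl⟩
      exact (φ i).2
    have hF : F = univ.image f := by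
      rw [← Finset.coe_inj, ← hr]; simp
    -- The minor is computed over `ℤ`, where a unit squares to 1, and then cast to `R`.
    have hm : ((reducedIncidence R src tgt).submatrix f id).det =
        (((reducedIncidence ℤ src tgt).submatrix f id).det : R) := by
      rw [← map_reducedIncidence]
      exact (RingHom.map_det (Int.castRingHom R) _).symm
    have hms : minorSqSum (reducedIncidence R src tgt) F =
        (((reducedIncidence ℤ src tgt).submatrix f id).det : R) ^ 2 := by
      rw [← hm, hF, minorSqSum_image _ hf]
    rw [hms, isSpanningTree_iff, ← hr]
    by_cases hconn : (SimpleGraph.fromEdgeSet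
        ((fun e => s(src e, tgt e)) '' Set.range f)).Connected
    · rw [if_pos ⟨hc, hconn⟩]
      have := Int.isUnit_sq (isUnit_det_reducedIncidence hconn)
      rw [← Int.cast_pow, this]; simp
    · rw [if_neg (fun h => hconn h.2), det_reducedIncidence_eq_zero hconn]; simp
  · rw [if_neg (fun h => hc (isSpanningTree_iff.1 h).1), minorSqSum_of_card_ne _ hc, mul_zero]

end MatrixTree

/-! ### Determinants of the radial tridiagonal blocks -/

section RadialMatrix

open Finset Matrix

variable {R : Type*} [CommRing R]

/-- The tridiagonal matrix with `-x` beside the diagonal and `2 * x + μ` on it, except for the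
last diagonal entry, which is `x + μ`. -/
def radialMatrix (k : ℕ) (x μ : R) : Matrix (Fin k) (Fin k) R := fun i j =>
  if i = j then (if i.val + 1 = k then x + μ else 2 * x + μ)
  else if i.val + 1 = j.val ∨ j.val + 1 = i.val then -x else 0

theorem det_radialMatrix_one (x μ : R) : (radialMatrix 1 x μ).det = x + μ := by
  simp [radialMatrix]

/-- Expansion along the first row: the exceptional entry sits in the last row, so deleting leading
rows and columns preserves the shape. -/
theorem det_radialMatrix_add_two (k : ℕ) (x μ : R) :
    (radialMatrix (k + 2) x μ).det =
      (2 * x + μ) * (radialMatrix (k + 1) x μ).det - x ^ 2 * (radialMatrix k x μ).det := by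
  have h1 : (radialMatrix (k + 2) x μ).submatrix Fin.succ (Fin.succAbove 0) =
      radialMatrix (k + 1) x μ := by
    ext i j
    simp [radialMatrix, Fin.ext_iff]
  have h2 : ((radialMatrix (k + 2) x μ).submatrix Fin.succ (Fin.succAbove 1)).det =
      -x * (radialMatrix k x μ).det := by
    rw [det_succ_column_zero, Fin.sum_univ_succ, Finset.sum_eq_zero]
    · have : (((radialMatrix (k + 2) x μ).submatrix Fin.succ (Fin.succAbove 1)).submatrix
          (Fin.succAbove 0) Fin.succ) = radialMatrix k x μ := by
        ext i j
        have : (Fin.succAbove (1 : Fin (k + 2)) j.succ) = j.succ.succ := by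
          rw [← Fin.succ_zero_eq_one, Fin.succ_succAbove_succ]; simp
        simp [radialMatrix, this, Fin.ext_iff]
      rw [this]
      simp [radialMatrix]
    · intro i _
      simp [radialMatrix, Fin.ext_iff]
  rw [det_succ_row_zero, Fin.sum_univ_succ, Fin.sum_univ_succ, Finset.sum_eq_zero, h1]
  · rw [Fin.succ_zero_eq_one, h2]
    simp [radialMatrix]
    ring
  · intro i _
    simp [radialMatrix, Fin.ext_iff]

theorem det_radialMatrix_zero_right (k : ℕ) (x : R) : (radialMatrix k x 0).det = x ^ k := by
  induction k using Nat.twoStepInduction with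
  | zero => simp
  | one => rw [det_radialMatrix_one]; ring
  | more k ih1 ih2 =>
    rw [det_radialMatrix_add_two, ih1, ih2]; ring

/-- Both sides obey the recurrence with characteristic roots `r` and `s`. Multiplying by `r - s`
avoids division in the ring. -/
theorem det_radialMatrix_mul_sub (k : ℕ) {x μ r s : R} (hsum : r + s = 2 * x + μ)
    (hprod : r * s = x ^ 2) :
    (radialMatrix (k + 1) x μ).det * (r - s) =
      (μ + x) * (r ^ (k + 1) - s ^ (k + 1)) - x ^ 2 * (r ^ k - s ^ k) := by
  induction k using Nat.twoStepInduction with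
  | zero => rw [det_radialMatrix_one]; ring
  | one =>
    rw [det_radialMatrix_add_two, det_radialMatrix_one, ← hsum, ← hprod]
    simp
    ring
  | more k ih1 ih2 =>
    rw [det_radialMatrix_add_two, sub_mul, mul_assoc, mul_assoc, ih1, ih2, ← hsum, ← hprod]
    ring

/-- The matrix `Q` with `(Q g) m = g m - g (m - 1)`, where `g (-1) = 0`. -/
def backwardDifference (R : Type*) [Ring R] (M : ℕ) : Matrix (Fin M) (Fin M) R := fun m a =>
  (if m = a then 1 else 0) - (if m.val = a.val + 1 then 1 else 0)

/-- The last column of the difference matrix has no entry below the diagonal, which accounts for the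
smaller last diagonal entry. -/
theorem radialMatrix_eq (M : ℕ) (x μ : R) :
    radialMatrix M x μ =
      x • ((backwardDifference R M)ᵀ * backwardDifference R M) + μ • (1 : Matrix _ _ R) := by
  ext a b
  have h1 : ∑ m : Fin M, (if m.val = a.val + 1 then (1 : R) else 0) *
      (if m.val = b.val + 1 then 1 else 0) = if a = b ∧ a.val + 1 < M then 1 else 0 := by
    by_cases h : a.val + 1 < M
    · rw [Finset.sum_eq_single ⟨a.val + 1, h⟩]
      · simp [h, Fin.ext_iff]
      · intro m _ hm
        rw [if_neg (fun h' => hm (Fin.ext h')), zero_mul]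
      · simp
    · rw [Finset.sum_eq_zero]
      · simp [h]
      · intro m _
        rw [if_neg (by omega), zero_mul]
  have h2 : ((backwardDifference R M)ᵀ * backwardDifference R M) a b =
      (if a = b then 1 else 0) - (if a.val = b.val + 1 then 1 else 0)
        - (if b.val = a.val + 1 then 1 else 0) + if a = b ∧ a.val + 1 < M then 1 else 0 := by
    simp only [Matrix.mul_apply, Matrix.transpose_apply, backwardDifference, sub_mul, mul_sub,
      Finset.sum_sub_distrib, h1]
    have h3 : ∑ m : Fin M, (if m.val = a.val + 1 then (1 : R) else 0) *
        (if m = b then 1 else 0) = if b.val = a.val + 1 then 1 else 0 := by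
      simp only [mul_ite, mul_one, mul_zero, Finset.sum_ite_eq', mem_univ, if_true]
    have h4 : ∑ m : Fin M, (if m = a then (1 : R) else 0) *
        (if m.val = b.val + 1 then 1 else 0) = if a.val = b.val + 1 then 1 else 0 := by
      simp only [ite_mul, one_mul, zero_mul, Finset.sum_ite_eq', mem_univ, if_true]
    have h5 : ∑ m : Fin M, (if m = a then (1 : R) else 0) *
        (if m = b then 1 else 0) = if a = b then 1 else 0 := by
      simp only [ite_mul, one_mul, zero_mul, Finset.sum_ite_eq', mem_univ, if_true]
    rw [h3, h4, h5]
    ring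
  rw [Matrix.add_apply, Matrix.smul_apply, Matrix.smul_apply, h2, radialMatrix, Matrix.one_apply]
  have ha := a.isLt
  by_cases hab : a = b
  · subst hab
    by_cases h : a.val + 1 = M
    · have : a.val ≠ M := by omega
      simp [h, this]
    · have : a.val + 1 < M := by omega
      simp [h, this]; ring
  · have : a.val ≠ b.val := fun h => hab (Fin.ext h)
    by_cases h3 : a.val + 1 = b.val
    · have : a.val ≠ b.val + 1 := by omega
      simp [hab, h3, this]
    · by_cases h4 : b.val + 1 = a.val
      · have : b.val ≠ a.val + 1 := by omega
        simp [hab, h4, this]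
      · simp [hab, h3, h4, Ne.symm h3, Ne.symm h4]

end RadialMatrix

/-! ### Fourier diagonalization of the cobweb Laplacian -/

section Cobweb

open Finset Matrix

variable {N M : ℕ}

/-- The end vertex of an edge of the cobweb lattice at which the edge is indexed. -/
def cobwebSrc (N M : ℕ) : CobwebEdge N M → CobwebVertex N M
  | Sum.inl v => some v
  | Sum.inr v => some v

/-- The end vertex of an edge of the cobweb lattice opposite to `cobwebSrc`. -/
def cobwebTgt (N M : ℕ) : CobwebEdge N M → CobwebVertex N M
  | Sum.inl v => cobwebInner v
  | Sum.inr v => some (v.1, v.2 + 1)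

theorem cobwebEnds_eq (N M : ℕ) :
    cobwebEnds N M = fun e => s(cobwebSrc N M e, cobwebTgt N M e) := by
  ext1 e
  cases e <;> rfl

/-- The reduced incidence matrix of the cobweb lattice. -/
abbrev cobwebIncidence (N M : ℕ) : Matrix (CobwebEdge N M) (Fin M × ZMod N) ℂ :=
  reducedIncidence ℂ (cobwebSrc N M) (cobwebTgt N M)

/-- The character table of `ZMod N` on each circle, twisted by the additive character `χ`. -/
def circleFourier (M : ℕ) (χ : AddChar (ZMod N) ℂ) :
    Matrix (Fin M × ZMod N) (Fin M × ZMod N) ℂ :=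
  fun u c => if u.1 = c.1 then χ (u.2 * c.2) else 0

variable [NeZero N]

theorem cobwebIncidence_mul_circleFourier_inl (χ : AddChar (ZMod N) ℂ) (v c : Fin M × ZMod N) :
    (cobwebIncidence N M * circleFourier M χ) (Sum.inl v) c =
      backwardDifference ℂ M v.1 c.1 * χ (v.2 * c.2) := by
  rw [reducedIncidence_mul_apply]
  simp only [cobwebSrc, cobwebTgt, Option.elim_some, circleFourier, backwardDifference, cobwebInner]
  by_cases h : v.1.val = 0
  · have : v.1.val ≠ c.1.val + 1 := by omega
    simp [h]
  · have : (⟨v.1.val - 1, lt_of_le_of_lt (Nat.sub_le _ _) v.1.isLt⟩ : Fin M) = c.1 ↔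
        v.1.val = c.1.val + 1 := by
      rw [Fin.ext_iff]
      change v.1.val - 1 = c.1.val ↔ _
      omega
    simp [h, this, sub_mul]

theorem cobwebIncidence_mul_circleFourier_inr (χ : AddChar (ZMod N) ℂ) (v c : Fin M × ZMod N) :
    (cobwebIncidence N M * circleFourier M χ) (Sum.inr v) c =
      (if v.1 = c.1 then 1 else 0) * (1 - χ c.2) * χ (v.2 * c.2) := by
  rw [reducedIncidence_mul_apply]
  simp only [cobwebSrc, cobwebTgt, Option.elim_some, circleFourier]
  split_ifs
  · rw [add_mul, one_mul, AddChar.map_add_eq_mul]; ring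
  · simp

theorem sum_stdAddChar_inv_mul (k l : ZMod N) :
    ∑ i : ZMod N, (ZMod.stdAddChar (N := N))⁻¹ (i * k) * ZMod.stdAddChar (i * l) =
      if k = l then (N : ℂ) else 0 := by
  have := AddChar.sum_mulShift (l - k) (ZMod.isPrimitive_stdAddChar N)
  rw [ZMod.card] at this
  simp only [sub_eq_zero, eq_comm (a := l)] at this
  push_cast at this
  rw [← this]
  refine Finset.sum_congr rfl fun i _ => ?_
  rw [AddChar.inv_apply, ← AddChar.map_add_eq_mul]
  congr 1
  ring

theorem circleFourier_transpose_mul (M : ℕ) :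
    (circleFourier M (ZMod.stdAddChar (N := N))⁻¹)ᵀ * circleFourier M ZMod.stdAddChar =
      (N : ℂ) • (1 : Matrix (Fin M × ZMod N) (Fin M × ZMod N) ℂ) := by
  ext ⟨a, k⟩ ⟨b, l⟩
  rw [Matrix.mul_apply, Fintype.sum_prod_type]
  simp only [Matrix.transpose_apply, circleFourier, ite_mul, zero_mul, mul_ite, mul_zero]
  rw [Finset.sum_eq_single a]
  · by_cases hab : a = b
    · simp only [hab, if_true]
      rw [sum_stdAddChar_inv_mul]
      simp [Matrix.one_apply]
    · simp [hab]
  · intro m _ hm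
    simp [hm]
  · simp

/-- On both kinds of edges, incidence times Fourier matrix splits into a radial factor and a
character. Orthogonality of characters kills distinct frequencies. Using the inverse character on
the left replaces complex conjugation by a plain transpose. -/
theorem circleFourier_conj_laplacian (M : ℕ) (x y : ℂ) :
    (circleFourier M (ZMod.stdAddChar (N := N))⁻¹)ᵀ *
        ((cobwebIncidence N M)ᵀ * diagonal (cobwebWeight N M x y) * cobwebIncidence N M) *
          circleFourier M ZMod.stdAddChar =
      (N : ℂ) • blockDiagonal fun k : ZMod N =>
        radialMatrix M x (y * ((1 - (ZMod.stdAddChar (N := N))⁻¹ k) * (1 - ZMod.stdAddChar k))) := by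
  rw [Matrix.mul_assoc, Matrix.mul_assoc _ (cobwebIncidence N M), Matrix.mul_assoc (_ᵀ) (diagonal _),
    ← Matrix.mul_assoc, ← Matrix.transpose_mul, ← Matrix.mul_assoc]
  ext ⟨a, k⟩ ⟨b, l⟩
  rw [Matrix.mul_apply, Fintype.sum_sum_type]
  simp only [Matrix.mul_diagonal, Matrix.transpose_apply, cobwebIncidence_mul_circleFourier_inl,
    cobwebIncidence_mul_circleFourier_inr, cobwebWeight, Fintype.sum_prod_type]
  have h1 (m : Fin M) : ∑ i : ZMod N,
      backwardDifference ℂ M m a * (ZMod.stdAddChar (N := N))⁻¹ (i * k) * x *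
        (backwardDifference ℂ M m b * ZMod.stdAddChar (i * l)) =
      (backwardDifference ℂ M m a * backwardDifference ℂ M m b) *
        (x * if k = l then (N : ℂ) else 0) := by
    rw [← sum_stdAddChar_inv_mul, Finset.mul_sum, Finset.mul_sum]
    exact Finset.sum_congr rfl fun i _ => by ring
  have h2 (m : Fin M) : ∑ i : ZMod N,
      (if m = a then 1 else 0) * (1 - (ZMod.stdAddChar (N := N))⁻¹ k) *
        (ZMod.stdAddChar (N := N))⁻¹ (i * k) * y *
        ((if m = b then 1 else 0) * (1 - ZMod.stdAddChar l) * ZMod.stdAddChar (i * l)) =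
      ((if m = a then 1 else 0) * (if m = b then 1 else 0)) *
        (y * ((1 - (ZMod.stdAddChar (N := N))⁻¹ k) * (1 - ZMod.stdAddChar l)) *
          if k = l then (N : ℂ) else 0) := by
    rw [← sum_stdAddChar_inv_mul, Finset.mul_sum, Finset.mul_sum]
    exact Finset.sum_congr rfl fun i _ => by ring
  have h3 : ∑ m : Fin M, (if m = a then (1 : ℂ) else 0) * (if m = b then 1 else 0) =
      (1 : Matrix (Fin M) (Fin M) ℂ) a b := by
    simp [Matrix.one_apply, eq_comm]
  have h4 : ∑ m : Fin M, backwardDifference ℂ M m a * backwardDifference ℂ M m b =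
      ((backwardDifference ℂ M)ᵀ * backwardDifference ℂ M) a b := by
    rw [Matrix.mul_apply]; rfl
  simp only [h1, h2]
  rw [← Finset.sum_mul, ← Finset.sum_mul, h3, h4, Matrix.smul_apply, blockDiagonal_apply]
  by_cases hkl : k = l
  · subst hkl
    simp only [if_true, radialMatrix_eq, Matrix.add_apply, Matrix.smul_apply, smul_eq_mul]
    ring
  · simp [hkl]

theorem cobwebGF_eq_prod (N M : ℕ) [NeZero N] (x y : ℂ) :
    cobwebGF N M x y = ∏ k : ZMod N, (radialMatrix M x
      (y * ((1 - (ZMod.stdAddChar (N := N))⁻¹ k) * (1 - ZMod.stdAddChar k)))).det := by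
  rw [cobwebGF, cobwebEnds_eq, spanningTreeSum_eq_det, ← det_blockDiagonal]
  have h1 := congrArg Matrix.det (circleFourier_conj_laplacian (N := N) M x y)
  have h2 := congrArg Matrix.det (circleFourier_transpose_mul (N := N) M)
  rw [det_mul, det_mul, det_smul] at h1
  rw [det_mul, det_smul, det_one, mul_one] at h2
  -- Both determinant identities carry the same power of `N`, which cancels.
  have hN : (N : ℂ) ^ Fintype.card (Fin M × ZMod N) ≠ 0 :=
    pow_ne_zero _ (Nat.cast_ne_zero.2 (NeZero.ne N))
  refine mul_left_cancel₀ hN (Eq.trans ?_ h1)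
  rw [← h2]
  ring

theorem one_sub_stdAddChar_inv_mul (N : ℕ) [NeZero N] (j : ℕ) :
    (1 - (ZMod.stdAddChar (N := N))⁻¹ (j : ZMod N)) * (1 - ZMod.stdAddChar (j : ZMod N)) =
      4 * (Real.sin (Real.pi * j / N) : ℂ) ^ 2 := by
  have hz (j : ℤ) : ZMod.stdAddChar (N := N) (j : ZMod N) =
      Complex.exp ((Real.pi * j / N : ℂ) * Complex.I) ^ 2 := by
    rw [ZMod.stdAddChar_coe, ← Complex.exp_nat_mul]
    congr 1
    push_cast
    ring
  have h1 := hz j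
  have h2 := hz (-j)
  push_cast at h1 h2
  rw [AddChar.inv_apply, h1, h2]
  push_cast
  rw [Complex.sin, show (Real.pi * -(j : ℂ) / N) = -(Real.pi * j / N) by ring]
  have h3 : Complex.exp (-(Real.pi * j / N) * Complex.I) *
      Complex.exp ((Real.pi * j / N : ℂ) * Complex.I) = 1 := by
    rw [← Complex.exp_add]; simp
  -- With half-angle exponentials `p * q = 1`, the claim is a polynomial identity modulo `I ^ 2 =
  -- -1`.
  generalize Complex.exp (-(Real.pi * j / N) * Complex.I) = p at *
  generalize Complex.exp ((Real.pi * j / N : ℂ) * Complex.I) = q at *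
  have hI := Complex.I_sq
  linear_combination (p * q + 1 - 2) * h3 - (p - q) ^ 2 * hI

end Cobweb

theorem mainTheorem3 (N M : ℕ) [NeZero N] (hM : 1 ≤ M) (x y : ℂ)
    (a s lam₁ lam₂ : ℕ → ℂ)
    (ha : ∀ j, a j = (Real.sin (Real.pi * j / N) : ℂ))
    (hs : ∀ j, s j ^ 2 = a j ^ 2 * y ^ 2 + x * y)
    (hlam₁ : ∀ j, lam₁ j = 2 * a j * (a j * y + s j) + x)
    (hlam₂ : ∀ j, lam₂ j = 2 * a j * (a j * y - s j) + x)
    (hne : ∀ j ∈ Finset.Ico 1 N, lam₁ j ≠ lam₂ j) :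
    cobwebGF N M x y =
      x ^ M * ∏ j ∈ Finset.Ico 1 N,
        ((4 * a j ^ 2 * y + x) * (lam₁ j ^ M - lam₂ j ^ M)
            - x ^ 2 * (lam₁ j ^ (M - 1) - lam₂ j ^ (M - 1))) / (lam₁ j - lam₂ j) := by
  obtain ⟨k, rfl⟩ : ∃ k, M = k + 1 := ⟨M - 1, by omega⟩
  have hN : 0 < N := Nat.pos_of_ne_zero (NeZero.ne N)
  have hprod : cobwebGF N (k + 1) x y =
      ∏ j ∈ Finset.range N, (radialMatrix (k + 1) x (4 * a j ^ 2 * y)).det := by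
    rw [cobwebGF_eq_prod]
    symm
    refine Finset.prod_bij (fun j _ => (j : ZMod N)) (fun _ _ => Finset.mem_univ _) ?_ ?_ ?_
    · intro i hi j hj hij
      rw [Finset.mem_range] at hi hj
      have := (ZMod.natCast_eq_natCast_iff' i j N).1 hij
      rwa [Nat.mod_eq_of_lt hi, Nat.mod_eq_of_lt hj] at this
    · intro c _
      exact ⟨c.val, Finset.mem_range.2 c.val_lt, ZMod.natCast_zmod_val c⟩
    · intro j _
      rw [one_sub_stdAddChar_inv_mul, ← ha, mul_comm y]
  have ha0 : a 0 = 0 := by rw [ha]; simp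
  rw [hprod, Finset.range_eq_Ico, Finset.prod_eq_prod_Ico_succ_bot hN, ha0]
  congr 1
  -- The trivial character has `μ = 0`.
  · rw [show 4 * (0 : ℂ) ^ 2 * y = 0 by ring, det_radialMatrix_zero_right]
  · refine Finset.prod_congr rfl fun j hj => ?_
    rw [eq_div_iff (sub_ne_zero.2 (hne j hj)), det_radialMatrix_mul_sub k
      (r := lam₁ j) (s := lam₂ j), Nat.add_sub_cancel]
    · rw [hlam₁, hlam₂]; ring
    -- The defining equation of the square root makes the product of the roots `x ^ 2`, whichever
    -- root is chosen.
    · rw [hlam₁, hlam₂]; linear_combination (-4 * a j ^ 2) * hs j
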